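/- Let $A$ be a finite set and $R$ a set of non-empty subsets of $A$. For $X \subseteq A$ put $\delta(X) = |X| - |\{r \in R : r \subseteq X\}|$ and $d(X) = \min\{\delta(Y) : X \subseteq Y \subseteq A\}$. Write $(A;R) \in \mathcal{C}$ if $\delta(X) \ge 0$ for all $X \subseteq A$, and, for $k \in \mathbb{N}$, $(A;R) \in \mathcal{C}_k$ if moreover every $r \in R$ has at most $k$ elements. A subset $X \subseteq A$ is self-sufficient, written $X \le A$, if $\delta(X) \le \delta(Y)$ for all $Y$ with $X \subseteq Y \subseteq A$. For $(A;R) \in \mathcal{C}$ let $PG(A;R)$ be the pregeometry (matroid) on $A$ with closure operation $\mathrm{cl}(X) = \{y \in A : d(X \cup \{y\}) = d(X)\}$; its dimension (rank) function is $d$. **Corollary.** Let $m < n$ be natural numbers and let $(A;R) \in \mathcal{C}$ be such that there is a self-sufficient $C \le A$ with $|C| = n$, $d(C) = n-1$, and every subset of $C$ of size $n-1$ independent in $PG(A;R)$. If $(B;R') \in \mathcal{C}_m$, then $PG(A;R)$ is not isomorphic to $PG(B;R')$, that is, there is no bijection $A \to B$ that carries one pregeometry to the other. -/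

import Mathlib

/-- A set system `(A; R)` on a set `A`: a set `R` of finite non-empty subsets of `A`. -/
structure SetSystem (A : Type*) where
  /-- The members of `R`, called relations. -/
  rels : Finset (Finset A)
  nonempty_of_mem : ∀ r ∈ rels, r.Nonempty

namespace SetSystem

variable {A : Type*} [Fintype A] [DecidableEq A] (S : SetSystem A)

/-- `R[X]`, the set of all `r ∈ R` that are contained in `X`. -/
def relsIn (X : Finset A) : Finset (Finset A) := S.rels.filter (fun r => r ⊆ X)

/-- The predimension `δ(X) = |X| - |R[X]|`. -/
def predim (X : Finset A) : ℤ := (X.card : ℤ) - ((S.relsIn X).card : ℤ)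

/-- Membership of `(A; R)` in the class `𝒞`: `A` is finite and `δ(X) ≥ 0` for all `X ⊆ A`. -/
def MemC : Prop := ∀ X : Finset A, 0 ≤ S.predim X

/-- Membership of `(A; R)` in the class `𝒞_k`: it is in `𝒞`, and all sets in `R` have size
at most `k`. -/
def MemCk (k : ℕ) : Prop := S.MemC ∧ ∀ r ∈ S.rels, r.card ≤ k

/-- `X ≤ A`: the set `X` is self-sufficient in `(A; R)`. -/
def SelfSufficient (X : Finset A) : Prop := ∀ Y : Finset A, X ⊆ Y → S.predim X ≤ S.predim Y

/-- The dimension `d(X) = min {δ(Y) : X ⊆ Y ⊆ A}`. -/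
def dim (X : Finset A) : ℤ :=
  (Finset.univ.filter (fun Y : Finset A => X ⊆ Y)).inf' ⟨X, by simp⟩ S.predim

/-- The closure `cl(X) = {y ∈ A : d(X ∪ {y}) = d(X)}`. -/
def cl (X : Finset A) : Set A := {y | S.dim (insert y X) = S.dim X}

theorem dim_le {X Y : Finset A} (h : X ⊆ Y) : S.dim X ≤ S.predim Y :=
  Finset.inf'_le _ (by simpa using h)

theorem exists_dim_eq (X : Finset A) : ∃ Y, X ⊆ Y ∧ S.dim X = S.predim Y := by
  obtain ⟨Y, hY, h⟩ := Finset.exists_mem_eq_inf' (s := Finset.univ.filter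
    (fun Y : Finset A => X ⊆ Y)) ⟨X, by simp⟩ S.predim
  exact ⟨Y, by simpa using hY, h⟩

theorem dim_mono {X Y : Finset A} (h : X ⊆ Y) : S.dim X ≤ S.dim Y := by
  obtain ⟨Z, hZ, e⟩ := S.exists_dim_eq Y
  exact e ▸ S.dim_le (h.trans hZ)

set_option linter.unusedSectionVars false in
theorem predim_submod (X Y : Finset A) :
    S.predim (X ∪ Y) + S.predim (X ∩ Y) ≤ S.predim X + S.predim Y := by
  have h1 := Finset.card_union_add_card_inter X Y
  have h2 := Finset.card_union_add_card_inter (S.relsIn X) (S.relsIn Y)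
  have h3 : S.relsIn X ∩ S.relsIn Y = S.relsIn (X ∩ Y) := by
    ext r
    simp only [relsIn, Finset.mem_inter, Finset.mem_filter, Finset.subset_inter_iff]
    tauto
  have h4 : S.relsIn X ∪ S.relsIn Y ⊆ S.relsIn (X ∪ Y) := by
    intro r
    simp only [relsIn, Finset.mem_union, Finset.mem_filter]
    rintro (⟨h, h'⟩ | ⟨h, h'⟩)
    · exact ⟨h, h'.trans Finset.subset_union_left⟩
    · exact ⟨h, h'.trans Finset.subset_union_right⟩
  have h5 := Finset.card_le_card h4
  rw [h3] at h2
  simp only [predim]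
  omega

theorem dim_submod (X Y : Finset A) :
    S.dim (X ∪ Y) + S.dim (X ∩ Y) ≤ S.dim X + S.dim Y := by
  obtain ⟨X', hX, eX⟩ := S.exists_dim_eq X
  obtain ⟨Y', hY, eY⟩ := S.exists_dim_eq Y
  have h1 := S.dim_le (Finset.union_subset_union hX hY)
  have h2 := S.dim_le (Finset.inter_subset_inter hX hY)
  have h3 := S.predim_submod X' Y'
  omega

theorem dim_insert_le (X : Finset A) (a : A) : S.dim (insert a X) ≤ S.dim X + 1 := by
  obtain ⟨Y, hY, e⟩ := S.exists_dim_eq X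
  have h1 := S.dim_le (Finset.insert_subset_insert a hY)
  have h2 := Finset.card_insert_le a Y
  have h3 : (S.relsIn Y).card ≤ (S.relsIn (insert a Y)).card := by
    refine Finset.card_le_card fun r => ?_
    simp only [relsIn, Finset.mem_filter]
    exact fun h => ⟨h.1, h.2.trans (Finset.subset_insert a Y)⟩
  simp only [predim] at *
  omega

theorem cl_mono {X Y : Finset A} (h : X ⊆ Y) : S.cl X ⊆ S.cl Y := by
  intro a ha
  by_cases haY : a ∈ Y
  · simp [cl, Finset.insert_eq_self.2 haY]
  have h1 := S.dim_submod (insert a X) Y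
  have h2 : insert a X ∪ Y = insert a Y := by
    rw [Finset.insert_union, Finset.union_eq_right.2 h]
  have h3 : insert a X ∩ Y = X := by
    rw [Finset.insert_inter_of_notMem haY, Finset.inter_eq_left.2 h]
  have h4 := S.dim_mono (Finset.subset_insert a Y)
  have h5 : S.dim (insert a X) = S.dim X := ha
  rw [h2, h3] at h1
  show S.dim (insert a Y) = S.dim Y
  omega

theorem dim_eq_of_subset_cl {X Y : Finset A} (h : X ⊆ Y) (hY : ∀ a ∈ Y, a ∈ S.cl X) :
    S.dim Y = S.dim X := by
  have key : ∀ Z : Finset A, (∀ a ∈ Z, a ∈ S.cl X) → S.dim (X ∪ Z) = S.dim X := by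
    intro Z
    induction Z using Finset.induction_on with
    | empty => simp
    | insert a Z _ ih =>
      intro hZ
      have h1 : a ∈ S.cl (X ∪ Z) := S.cl_mono Finset.subset_union_left (hZ a (by simp))
      rw [Finset.union_insert, ← ih fun b hb => hZ b (by simp [hb])]
      exact h1
  have := key Y hY
  rwa [Finset.union_eq_right.2 h] at this

/-- A set `I` is independent if no `a ∈ I` lies in the closure of `I \ {a}`. -/
def IndepSet (I : Finset A) : Prop := ∀ a ∈ I, a ∉ S.cl (I.erase a)

theorem IndepSet.subset {I J : Finset A} (hJ : S.IndepSet J) (h : I ⊆ J) : S.IndepSet I :=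
  fun a ha hc => hJ a (h ha) (S.cl_mono (Finset.erase_subset_erase a h) hc)

theorem dim_le_card (X : Finset A) : S.dim X ≤ S.dim ∅ + X.card := by
  induction X using Finset.induction_on with
  | empty => simp
  | insert a X ha ih =>
    have := S.dim_insert_le X a
    rw [Finset.card_insert_of_notMem ha]
    push_cast
    omega

theorem indepSet_iff (I : Finset A) : S.IndepSet I ↔ S.dim I = S.dim ∅ + I.card := by
  constructor
  · induction I using Finset.induction_on with
    | empty => simp
    | insert a I ha ih =>
      intro hI
      have h1 := ih (IndepSet.subset S hI (Finset.subset_insert a I))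
      have h2 := hI a (by simp)
      rw [Finset.erase_insert ha] at h2
      have h3 : S.dim (insert a I) ≠ S.dim I := h2
      have h4 := S.dim_insert_le I a
      have h5 := S.dim_mono (Finset.subset_insert a I)
      rw [Finset.card_insert_of_notMem ha]
      push_cast
      omega
  · intro h a ha hc
    have h1 : S.dim (insert a (I.erase a)) = S.dim (I.erase a) := hc
    rw [Finset.insert_erase ha] at h1
    have h2 := S.dim_le_card (I.erase a)
    have h3 := Finset.card_erase_add_one ha
    omega

theorem indepSet_insert {I : Finset A} {a : A} (hI : S.IndepSet I) (ha : a ∉ S.cl I) :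
    S.IndepSet (insert a I) := by
  have haI : a ∉ I := fun h => ha (by simp [cl, Finset.insert_eq_self.2 h])
  rw [indepSet_iff] at hI ⊢
  have h1 : S.dim (insert a I) ≠ S.dim I := ha
  have h2 := S.dim_insert_le I a
  have h3 := S.dim_mono (Finset.subset_insert a I)
  rw [Finset.card_insert_of_notMem haI]
  push_cast
  omega

theorem indepSet_aug {I J : Finset A} (hI : S.IndepSet I) (hJ : S.IndepSet J)
    (hlt : I.card < J.card) : ∃ e ∈ J, e ∉ I ∧ S.IndepSet (insert e I) := by
  by_contra hcon
  have hcl : ∀ a ∈ I ∪ J, a ∈ S.cl I := by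
    intro a ha
    by_cases haI : a ∈ I
    · simp [cl, Finset.insert_eq_self.2 haI]
    by_contra hac
    exact hcon ⟨a, (Finset.mem_union.1 ha).resolve_left haI, haI, S.indepSet_insert hI hac⟩
  have h1 := S.dim_eq_of_subset_cl Finset.subset_union_left hcl
  have h2 := S.dim_mono (Finset.subset_union_right (s₁ := I) (s₂ := J))
  rw [indepSet_iff] at hI hJ
  omega

/-- The pregeometry `PG(A; R)` given by the closure `cl`, as a matroid on `A`. That its closure
operation is `cl`, and that its rank function is `d` when `(A; R)` is in `𝒞`, is shown below. -/
def PG : Matroid A :=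
  (IndepMatroid.ofFinset Set.univ S.IndepSet (fun a ha => by simp at ha)
    (fun _ _ hJ h => IndepSet.subset S hJ h)
    (fun _ _ hI hJ hlt => S.indepSet_aug hI hJ hlt)
    (fun _ _ => Set.subset_univ _)).matroid

@[simp] theorem PG_ground : S.PG.E = Set.univ := rfl

theorem PG_indep (I : Finset A) : S.PG.Indep (I : Set A) ↔ S.IndepSet I :=
  IndepMatroid.ofFinset_indep Set.univ S.IndepSet (fun a ha => by simp at ha)
    (fun _ _ hJ h => IndepSet.subset S hJ h)
    (fun _ _ hI hJ hlt => S.indepSet_aug hI hJ hlt)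
    (fun _ _ => Set.subset_univ _)

theorem exists_PG_isBasis (X : Finset A) :
    ∃ I : Finset A, S.PG.IsBasis (I : Set A) (X : Set A) ∧ S.IndepSet I ∧ I ⊆ X ∧
      ∀ a ∈ X, a ∈ S.cl I := by
  obtain ⟨I', hI'⟩ := S.PG.exists_isBasis (X : Set A)
  obtain ⟨I, rfl⟩ := (Set.toFinite I').exists_finset_coe
  have hI := (S.PG_indep I).1 hI'.indep
  refine ⟨I, hI', hI, by exact_mod_cast hI'.subset, fun a ha => ?_⟩
  by_contra hac
  have h1 := S.indepSet_insert hI hac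
  rw [← PG_indep, Finset.coe_insert] at h1
  have h2 : a ∈ I := by exact_mod_cast hI'.mem_of_insert_indep (by exact_mod_cast ha) h1
  exact hac (by simp [cl, Finset.insert_eq_self.2 h2])

/-- The closure operation of the matroid `PG(A; R)` is `cl`. -/
theorem PG_closure (X : Finset A) : S.PG.closure (X : Set A) = S.cl X := by
  obtain ⟨I, hIX, hI, hsub, hcl⟩ := S.exists_PG_isBasis X
  have hdim := S.dim_eq_of_subset_cl hsub hcl
  rw [← hIX.closure_eq_closure]
  ext a
  rw [hIX.indep.mem_closure_iff', ← Finset.coe_insert, PG_indep]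
  constructor
  · rintro ⟨-, h⟩
    refine S.cl_mono hsub ?_
    by_contra hac
    exact hac (by simp [cl, Finset.insert_eq_self.2 (Finset.mem_coe.1
      (h (S.indepSet_insert hI hac)))])
  · intro ha
    refine ⟨trivial, fun h => ?_⟩
    by_contra haI
    rw [Finset.mem_coe] at haI
    rw [indepSet_iff, Finset.card_insert_of_notMem haI] at h
    rw [indepSet_iff] at hI
    have h1 : S.dim (insert a X) = S.dim X := ha
    have h2 := S.dim_mono (Finset.insert_subset_insert a hsub)
    push_cast at h
    omega

/-- For `(A; R)` in `𝒞`, the dimension function of the pregeometry `PG(A; R)` is `d`. -/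
theorem PG_eRk (hS : S.MemC) (X : Finset A) : ((S.PG.eRk (X : Set A)).toNat : ℤ) = S.dim X := by
  obtain ⟨I, hIX, hI, hsub, hcl⟩ := S.exists_PG_isBasis X
  have hdim := S.dim_eq_of_subset_cl hsub hcl
  have h0 : S.dim ∅ = 0 := by
    obtain ⟨Y, -, e⟩ := S.exists_dim_eq ∅
    have h1 := hS Y
    have h2 := S.dim_le (Finset.Subset.refl ∅)
    have h3 : S.predim ∅ ≤ 0 := by simp [predim]
    omega
  rw [hIX.eRk_eq_encard, Set.encard_coe_eq_coe_finsetCard, ENat.toNat_natCast]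
  rw [indepSet_iff] at hI
  omega

end SetSystem

/-- Two matroids are isomorphic if a bijection of the underlying sets carries one to the other
(equivalently, preserves independence, or closure). -/
def Matroid.Isomorphic {A B : Type*} (M : Matroid A) (N : Matroid B) : Prop :=
  ∃ e : A ≃ B, M.mapEquiv e = N

/-! The pregeometry determines how many relations have a given closure. If `F` is closed, then `δ(F)
= d(F)`, and a relation lies in `F` exactly when its closure does; so `|F| - d(F)` relations have
closure inside `F`, a number visible in the pregeometry. Induction over subsets recovers the number
with closure exactly `F` (`card_filter_clFinset_eq`). The set `C` is itself a relation, so an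
isomorphic `PG(B;R')` has a relation whose closure has dimension `n - 1`. A relation has dimension
less than its size, so this one has at least `n > m` elements. -/

/-- The members of a finite family of finite sets contained in `F`, counted by their value. -/
theorem Finset.card_filter_subset_eq_add_sum {α γ : Type*} [DecidableEq γ] (s : Finset α)
    (f : α → Finset γ) (F : Finset γ) :
    (s.filter (fun x => f x ⊆ F)).card = (s.filter (fun x => f x = F)).card +
      ∑ G ∈ F.ssubsets, (s.filter (fun x => f x = G)).card := by
  rw [Finset.card_eq_sum_card_fiberwise (f := f) (t := F.powerset)
    (fun x hx => by simpa using (Finset.mem_filter.1 hx).2),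
    ← Finset.add_sum_erase _ _ (Finset.mem_powerset_self F)]
  have e : ∀ G, G ⊆ F → (s.filter (fun x => f x ⊆ F)).filter (fun x => f x = G) =
      s.filter (fun x => f x = G) := by
    intro G hG
    ext x
    simp only [Finset.mem_filter]
    exact ⟨fun hx => ⟨hx.1.1, hx.2⟩, fun hx => ⟨⟨hx.1, hx.2 ▸ hG⟩, hx.2⟩⟩
  rw [e F subset_rfl]
  congr 1
  exact Finset.sum_congr rfl fun G hG => by rw [e G (Finset.mem_ssubsets.1 hG).1]

/-- If the numbers of members of two finite families of finite sets contained in `F` agree for all `F`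
in a collection containing both families, then every set occurs equally often in both. -/
theorem Finset.card_fiber_eq_of_card_subset_eq {α β γ : Type*} [DecidableEq γ]
    (s : Finset α) (t : Finset β) (f : α → Finset γ) (g : β → Finset γ) (P : Finset γ → Prop)
    (hf : ∀ x ∈ s, P (f x)) (hg : ∀ x ∈ t, P (g x))
    (h : ∀ F, P F → (s.filter (fun x => f x ⊆ F)).card = (t.filter (fun x => g x ⊆ F)).card)
    (F : Finset γ) : (s.filter (fun x => f x = F)).card = (t.filter (fun x => g x = F)).card := by
  induction F using Finset.strongInduction with
  | H F ih =>
    by_cases hF : P F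
    · have h1 := h F hF
      -- Proper subsets of `F` contribute equally by induction, which leaves the terms for `F`
      -- itself.
      rw [card_filter_subset_eq_add_sum, card_filter_subset_eq_add_sum,
        Finset.sum_congr rfl fun G hG => ih G (Finset.mem_ssubsets.1 hG)] at h1
      omega
    · have hs : s.filter (fun x => f x = F) = ∅ :=
        Finset.filter_eq_empty_iff.2 fun x hx hx' => hF (hx' ▸ hf x hx)
      have ht : t.filter (fun x => g x = F) = ∅ :=
        Finset.filter_eq_empty_iff.2 fun x hx hx' => hF (hx' ▸ hg x hx)
      rw [hs, ht, Finset.card_empty, Finset.card_empty]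

/-! ### Closed sets and the relations inside them -/

namespace SetSystem

variable {A : Type*} [Fintype A] [DecidableEq A] (S : SetSystem A)

variable {S} in
theorem MemC.dim_nonneg (hS : S.MemC) (X : Finset A) : 0 ≤ S.dim X := by
  obtain ⟨Y, -, e⟩ := S.exists_dim_eq X
  exact e ▸ hS Y

/-- The closure of a finite set, as a finite set. -/
def clFinset (X : Finset A) : Finset A := Finset.univ.filter (fun y => S.dim (insert y X) = S.dim X)

theorem mem_clFinset {X : Finset A} {y : A} :
    y ∈ S.clFinset X ↔ S.dim (insert y X) = S.dim X := by
  simp [clFinset]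

theorem subset_clFinset (X : Finset A) : X ⊆ S.clFinset X := fun y hy =>
  S.mem_clFinset.2 (by rw [Finset.insert_eq_self.2 hy])

theorem clFinset_mono {X Y : Finset A} (h : X ⊆ Y) : S.clFinset X ⊆ S.clFinset Y := fun _ hy =>
  S.mem_clFinset.2 (S.cl_mono h (S.mem_clFinset.1 hy))

theorem dim_clFinset (X : Finset A) : S.dim (S.clFinset X) = S.dim X :=
  S.dim_eq_of_subset_cl (S.subset_clFinset X) fun _ ha => S.mem_clFinset.1 ha

theorem subset_clFinset_of_dim_eq {X Y : Finset A} (h : X ⊆ Y) (hd : S.dim Y = S.dim X) :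
    Y ⊆ S.clFinset X := by
  intro y hy
  have h1 := S.dim_mono (Finset.insert_subset hy h)
  have h2 := S.dim_mono (Finset.subset_insert y X)
  rw [mem_clFinset]
  omega

theorem clFinset_clFinset (X : Finset A) : S.clFinset (S.clFinset X) = S.clFinset X := by
  refine (S.subset_clFinset_of_dim_eq ((S.subset_clFinset X).trans (S.subset_clFinset _)) ?_).antisymm
    (S.subset_clFinset _)
  rw [dim_clFinset, dim_clFinset]

/-- A set `Y ⊇ F` attaining the minimum has `d(Y) ≤ δ(Y) = d(F)`, so it lies in the closure of `F`,
which is `F`. -/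
theorem predim_eq_dim_of_closed {F : Finset A} (hF : S.clFinset F = F) : S.predim F = S.dim F := by
  obtain ⟨Y, hFY, e⟩ := S.exists_dim_eq F
  have h1 := S.dim_le (Finset.Subset.refl Y)
  have h2 := S.dim_mono hFY
  have h3 := S.subset_clFinset_of_dim_eq hFY (by omega)
  rw [hF] at h3
  rw [e, hFY.antisymm h3]

theorem clFinset_subset_iff {F X : Finset A} (hF : S.clFinset F = F) :
    S.clFinset X ⊆ F ↔ X ⊆ F :=
  ⟨(S.subset_clFinset X).trans, fun h => (S.clFinset_mono h).trans hF.le⟩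

/-- The right-hand side depends only on the pregeometry, which makes the count an isomorphism
invariant. -/
theorem card_filter_clFinset_subset {F : Finset A} (hF : S.clFinset F = F) :
    ((S.rels.filter (fun r => S.clFinset r ⊆ F)).card : ℤ) = F.card - S.dim F := by
  have h : S.rels.filter (fun r => S.clFinset r ⊆ F) = S.relsIn F :=
    Finset.filter_congr fun r _ => S.clFinset_subset_iff hF
  rw [h, ← S.predim_eq_dim_of_closed hF, predim]
  omega

theorem dim_lt_card_of_mem_rels {r X : Finset A} (hr : r ∈ S.rels) (h : r ⊆ X) :
    S.dim X < X.card := by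
  have h1 := S.dim_le (Finset.Subset.refl X)
  have h2 : 0 < (S.relsIn X).card :=
    Finset.card_pos.2 ⟨r, by simp [relsIn, hr, h]⟩
  simp only [predim] at h1
  omega

/-- A self-sufficient circuit is a relation. -/
theorem mem_rels_of_selfSufficient_circuit (hS : S.MemC) {C : Finset A} (hC : S.SelfSufficient C)
    (hdim : S.dim C = (C.card : ℤ) - 1)
    (hindep : ∀ X : Finset A, X ⊆ C → X.card = C.card - 1 → S.PG.Indep (X : Set A)) :
    C ∈ S.rels := by
  obtain ⟨Y, hCY, e⟩ := S.exists_dim_eq C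
  have h1 := hC Y hCY
  -- Here `δ(C) ≤ δ(Y) = d(C) = |C| - 1`, so `C` contains a relation.
  have h2 : 0 < (S.relsIn C).card := by
    simp only [predim] at *
    omega
  obtain ⟨r, hr⟩ := Finset.card_pos.1 h2
  obtain ⟨hr', hrC⟩ := Finset.mem_filter.1 hr
  obtain rfl | hne := eq_or_ne r C
  · exact hr'
  -- A relation missing some `a ∈ C` would make the independent set `C \ {a}` dependent.
  obtain ⟨a, haC, har⟩ := Finset.exists_of_ssubset (hrC.ssubset_of_ne hne)
  have h3 := hindep (C.erase a) (Finset.erase_subset a C) (Finset.card_erase_of_mem haC)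
  rw [PG_indep] at h3
  have h4 := S.dim_lt_card_of_mem_rels hr' (Finset.subset_erase.2 ⟨hrC, har⟩)
  have h5 := hS.dim_nonneg ∅
  rw [indepSet_iff] at h3
  omega

/-! ### Transfer along an isomorphism -/

variable {B : Type*} [Fintype B] [DecidableEq B] {T : SetSystem B} {S}

/-- In `𝒞` the dimension is the matroid rank, and an isomorphism carries bases to bases. -/
theorem dim_map_equiv (hS : S.MemC) (hT : T.MemC) {e : A ≃ B} (h : S.PG.mapEquiv e = T.PG)
    (X : Finset A) : T.dim (X.map e.toEmbedding) = S.dim X := by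
  rw [← PG_eRk S hS, ← PG_eRk T hT, ← h]
  obtain ⟨I, hI, -⟩ := S.exists_PG_isBasis X
  have hI' : (S.PG.mapEquiv e).IsBasis (e '' I) (e '' X) := by
    rw [Matroid.mapEquiv_isBasis_iff]
    simpa using hI
  rw [hI.eRk_eq_encard, Finset.coe_map, Equiv.coe_toEmbedding, hI'.eRk_eq_encard,
    e.injective.encard_image]

theorem clFinset_map_equiv {e : A ≃ B} (h : ∀ X, T.dim (X.map e.toEmbedding) = S.dim X)
    (X : Finset A) : T.clFinset (X.map e.toEmbedding) = (S.clFinset X).map e.toEmbedding := by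
  ext y
  obtain ⟨x, rfl⟩ := e.surjective y
  rw [mem_clFinset, Finset.mem_map_equiv, e.symm_apply_apply, mem_clFinset, ← h X,
    ← h (insert x X), Finset.map_insert]
  rfl

/-- Isomorphic pregeometries have, for each `F`, equally many relations with closure `F`. -/
theorem card_filter_clFinset_eq {e : A ≃ B} (h : ∀ X, T.dim (X.map e.toEmbedding) = S.dim X)
    (F : Finset A) : (S.rels.filter (fun r => S.clFinset r = F)).card =
      (T.rels.filter (fun r => T.clFinset r = F.map e.toEmbedding)).card := by
  have hm' : ∀ (X : Finset B), (X.map e.symm.toEmbedding).map e.toEmbedding = X := by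
    intro X
    ext y
    simp [Finset.mem_map_equiv]
  have hm : ∀ (X : Finset B) (F : Finset A), X.map e.symm.toEmbedding ⊆ F ↔
      X ⊆ F.map e.toEmbedding := by
    intro X F
    rw [← Finset.map_subset_map (f := e.toEmbedding), hm']
  -- Closures in `B` are pulled back to `A`, so that both families consist of closed subsets of `A`.
  have key := Finset.card_fiber_eq_of_card_subset_eq S.rels T.rels S.clFinset
    (fun r => (T.clFinset r).map e.symm.toEmbedding) (fun F => S.clFinset F = F)
    (fun r _ => S.clFinset_clFinset r)
    (fun r _ => by
      apply Finset.map_injective e.toEmbedding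
      rw [← clFinset_map_equiv h, hm', clFinset_clFinset])
    (fun F hF => by
      have h1 := S.card_filter_clFinset_subset hF
      have h2 := T.card_filter_clFinset_subset (F := F.map e.toEmbedding)
        (by rw [clFinset_map_equiv h, hF])
      rw [Finset.card_map, h] at h2
      simp only [hm]
      omega) F
  rw [key]
  congr 1
  refine Finset.filter_congr fun r _ => ?_
  rw [← (Finset.map_injective e.toEmbedding).eq_iff, hm']

end SetSystem

theorem mainTheorem7 {A B : Type*} [Fintype A] [DecidableEq A] [Fintype B] [DecidableEq B]
    (m n : ℕ) (hmn : m < n)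
    (S : SetSystem A) (hS : S.MemC)
    (C : Finset A) (hC : S.SelfSufficient C) (hcard : C.card = n)
    (hdim : S.dim C = (n : ℤ) - 1)
    (hindep : ∀ X : Finset A, X ⊆ C → X.card = n - 1 → S.PG.Indep (X : Set A))
    (T : SetSystem B) (hT : T.MemCk m) :
    ¬ S.PG.Isomorphic T.PG := by
  rintro ⟨e, he⟩
  subst hcard
  have hd := SetSystem.dim_map_equiv hS hT.1 he
  have hmem := S.mem_rels_of_selfSufficient_circuit hS hC hdim hindep
  have hpos : 0 < (S.rels.filter (fun r => S.clFinset r = S.clFinset C)).card :=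
    Finset.card_pos.2 ⟨C, by simp [hmem]⟩
  rw [SetSystem.card_filter_clFinset_eq hd] at hpos
  obtain ⟨r, hr⟩ := Finset.card_pos.1 hpos
  obtain ⟨hr, hrC⟩ := Finset.mem_filter.1 hr
  -- The relation `r` has dimension `n - 1`, which is less than `|r| ≤ m`.
  have h1 := T.dim_clFinset r
  rw [hrC, hd, S.dim_clFinset, hdim] at h1
  have h2 := T.dim_lt_card_of_mem_rels hr subset_rfl
  have h3 := hT.2 r hr
  omega
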